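/- Let $X$ be a finite or infinite countable set and let $k(x,y)$, $x,y\in X$, be the transition rates of a continuous-time Markov chain $(Z_t)_{t\ge 0}$ on $X$ (the minimal chain with these rates): $k(x,y)\ge 0$ for $x\ne y$, $\sum_{y} k(x,y)=0$, and, for every $x\in X$, $$M_1(x)=\sum_{y\neq x}k(x,y)<\infty ,\qquad M_2(x)=\sum_{y\ne x}k(x,y)\,M_1(y)<\infty .$$ Let $L f(x)=\sum_{y} k(x,y)f(y)$ denote its generator and, for bounded $f:X\to\mathbb R$, let $P_tf(x)=\mathbb E\big(f(Z_t)\,\big|\,Z_0=x\big)$ denote its semigroup (with the convention $f(Z_t)=0$ after a possible explosion). Assume that the chain is irreducible and that $\mu$ is a probability measure on $X$ satisfying detailed balance, $\mu(\{x\})k(x,y)=\mu(\{y\})k(y,x)$ for all $x,y\in X$. For positive $f$, with $f\in\ell^1(\mu)$ in the first formula, put $$\mathrm{Ent}_\mu(f)=\int_X f\log f\,d\mu-\int_X f\,d\mu\,\log\int_X f\,d\mu ,$$ $$\mathcal I(f)=\frac12\sum_{x,y\in X}k(x,y)\big(f(y)-f(x)\big)\big(\log f(y)-\log f(x)\big)\mu(\{x\}),$$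 both with values in $[0,\infty]$. Let $\Phi:(0,\infty)\to(0,\infty)$ be a strictly increasing, concave $C^1$ function, set $\Phi(0):=\lim_{r\to0^+}\Phi(r)$, and assume that $L$ satisfies the entropy-information inequality $EI(\Phi)$: for every $f:X\to(0,\infty)$ with $\int_X f\,d\mu=1$, $\mathrm{Ent}_\mu(f)<\infty$ and $\mathcal I(f)<\infty$, $$\mathrm{Ent}_\mu(f)\le\Phi(\mathcal I(f)).$$ Assume moreover that $M_1\in\ell^1(\mu)$. Then for all $1\le p\le q\le\infty$, every bounded $f:X\to\mathbb R$ and every $\varrho>0$, $$\big\|e^{P_{t(\varrho)}f}\big\|_q\le\big\|e^{f}\big\|_p\,e^{m(\varrho)},\qquad t(\varrho)=\int_p^q\frac{\Phi'(\varrho r)}{r}\,dr,\quad m(\varrho)=\frac{\Phi(\varrho p)}{p}-\frac{\Phi(\varrho q)}{q},$$ where $\|\cdot\|_p$ is the norm of $\ell^p(\mu)$ and the case $q=\infty$ is understood as follows. If $r\mapsto\Phi'(r)/r$ is integrable at $\infty$ and $1\le p<\infty$, then both expressions $t(\varrho)$ and $m(\varrho)$ have finite limits as $q\to\infty$, and the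 inequality holds with $q=\infty$ and these limits. If $r\mapsto\Phi'(r)/r$ is not integrable at $\infty$, then $t(\varrho)\to\infty$ as $q\to\infty$ for every $1\le p<\infty$, so that $q=\infty$ is not reached. For $p=q=\infty$ one puts $t(\varrho)=m(\varrho)=0$. -/

import Mathlib

open MeasureTheory Filter Topology Set
open scoped ENNReal

noncomputable section

namespace MarkovEI

variable {X : Type*}

/-- Total jump rate `M₁(x) = ∑_{y ≠ x} k(x,y)`. -/
def M1 (k : X → X → ℝ) (x : X) : ℝ := ∑' y : {y : X // y ≠ x}, k x y

/-- Rates of a Markov generator `L f(x) = ∑_y k(x,y) f(y)` on a countable state space: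
nonnegative off the diagonal and with vanishing (absolutely convergent) row sums, so that
`M₁(x) = -k(x,x) < ∞`; and `M₂(x) = ∑_{y ≠ x} k(x,y) M₁(y) < ∞` at every `x`. -/
structure IsRateMatrix (k : X → X → ℝ) : Prop where
  nonneg : ∀ x y, x ≠ y → 0 ≤ k x y
  rowSum : ∀ x, HasSum (fun y => k x y) 0
  M2_finite : ∀ x, Summable (fun y : {y : X // y ≠ x} => k x y * M1 k y)

/-- Every state can be reached from every other one through jumps of positive rate. -/
def IsIrreducible (k : X → X → ℝ) : Prop :=
  ∀ x y, Relation.ReflTransGen (fun a b => a ≠ b ∧ 0 < k a b) x y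

/-- Detailed balance `μ({x}) k(x,y) = μ({y}) k(y,x)`. -/
def DetailedBalance [MeasurableSpace X] (k : X → X → ℝ) (μ : Measure X) : Prop :=
  ∀ x y, μ.real {x} * k x y = μ.real {y} * k y x

open Classical in
/-- `jumpProb k n t x y` is the probability that the chain started at `x` performs exactly `n`
jumps up to time `t ≥ 0` and sits in `y` at time `t`. The chain waits in `x` for an exponential
time of rate `M₁(x)` and then jumps to `z ≠ x` at rate `k(x,z)`; the recursion conditions on the
time `s` and the target `z` of the first jump. -/
def jumpProb (k : X → X → ℝ) : ℕ → ℝ → X → X → ℝ≥0∞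
  | 0, t, x, y => if x = y then ENNReal.ofReal (Real.exp (-(M1 k x * t))) else 0
  | n + 1, t, x, y =>
      ∫⁻ s in Ioc 0 t, ENNReal.ofReal (Real.exp (-(M1 k x * s))) *
        ∑' z : {z : X // z ≠ x}, ENNReal.ofReal (k x z) * jumpProb k n (t - s) z y

/-- The transition function `p_t(x,y) = ℙ(Z_t = y | Z_0 = x)` of the (minimal) continuous-time
Markov chain with rates `k`. -/
def transitionProb (k : X → X → ℝ) (t : ℝ) (x y : X) : ℝ≥0∞ := ∑' n, jumpProb k n t x y

/-- The (sub-)Markov semigroup `P_t f(x) = 𝔼(f(Z_t) | Z_0 = x)`, for bounded `f`. -/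
def semigroup (k : X → X → ℝ) (t : ℝ) (f : X → ℝ) (x : X) : ℝ :=
  ∑' y, (transitionProb k t x y).toReal * f y

/-- `Ent_μ(f) = ∫ f log f dμ - ∫ f dμ · log ∫ f dμ`. For a positive `f ∈ ℓ¹(μ)` and a finite
measure `μ`, this is the entropy when `f log f` is integrable, and otherwise the entropy is `∞`
(the negative part of `f log f` being bounded). -/
def entropy [MeasurableSpace X] (μ : Measure X) (f : X → ℝ) : ℝ :=
  ∫ x, f x * Real.log (f x) ∂μ - (∫ x, f x ∂μ) * Real.log (∫ x, f x ∂μ)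

/-- The Fisher information
`𝓘(f) = 1/2 ∑_{x,y} k(x,y) (f(y) - f(x)) (log f(y) - log f(x)) μ({x})` in `[0,∞]`, for `f > 0`
(all summands are nonnegative). -/
def fisherInfo [MeasurableSpace X] (k : X → X → ℝ) (μ : Measure X) (f : X → ℝ) : ℝ≥0∞ :=
  2⁻¹ * ∑' x, ∑' y, ENNReal.ofReal
    (k x y * (f y - f x) * (Real.log (f y) - Real.log (f x)) * μ.real {x})

/-- Growth functions: strictly increasing, concave `C¹` functions `Φ : (0,∞) → (0,∞)`
(the values of `Φ` on `(-∞,0]` are irrelevant). -/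
structure IsGrowthFunction (Φ : ℝ → ℝ) : Prop where
  pos : ∀ r, 0 < r → 0 < Φ r
  strictMono : StrictMonoOn Φ (Ioi 0)
  concave : ConcaveOn ℝ (Ioi 0) Φ
  contDiff : ContDiffOn ℝ 1 Φ (Ioi 0)

/-- The value of the growth function at `r ≥ 0`, with `Φ(0) := lim_{r → 0+} Φ(r)`. -/
def growthValue (Φ : ℝ → ℝ) (r : ℝ) : ℝ := if r = 0 then Function.rightLim Φ 0 else Φ r

/-- The entropy-information inequality `EI(Φ)`: `Ent_μ(f) ≤ Φ(𝓘(f))` for every strictly positive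
probability density `f` with respect to `μ` with `Ent_μ(f) < ∞` and `𝓘(f) < ∞`. -/
def SatisfiesEI [MeasurableSpace X] (k : X → X → ℝ) (μ : Measure X) (Φ : ℝ → ℝ) : Prop :=
  ∀ f : X → ℝ, (∀ x, 0 < f x) → Integrable f μ → ∫ x, f x ∂μ = 1 →
    Integrable (fun x => f x * Real.log (f x)) μ → fisherInfo k μ f ≠ ∞ →
    entropy μ f ≤ growthValue Φ (fisherInfo k μ f).toReal

/-- `t(ϱ) = ∫_p^q Φ'(ϱ r) / r dr` for finite `p, q`. -/
def timeOf (Φ : ℝ → ℝ) (ρ p q : ℝ) : ℝ := ∫ r in p..q, deriv Φ (ρ * r) / r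

/-- `m(ϱ) = Φ(ϱ p) / p - Φ(ϱ q) / q` for finite `p, q`. -/
def expOf (Φ : ℝ → ℝ) (ρ p q : ℝ) : ℝ := Φ (ρ * p) / p - Φ (ρ * q) / q

end MarkovEI

end

/-! Put `t(r) = timeOf Φ ρ p r`, `u = P_{t(r)} f` and `Z(r) = ∫ exp (r * u) dμ`. The theorem says
that `r ↦ log Z(r) / r + Φ(ρ r) / r` decreases on `[p, ∞)`; comparing its values at `p`, where `t =
0`, and at `q` gives the bound (`antitoneOn_log_integral_exp`).

Since `t'(r) = Φ'(ρ r) / r`, the backward equation gives `Z' = ∫ (u + Φ'(ρ r) L u) exp (r u) dμ`.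
The density `g = exp (r u) / Z` has entropy `(r/Z) ∫ u exp (r u) dμ - log Z`. Because `log g` is
affine in `u`, reversibility yields the exact identity `𝓘(g) = -(r/Z) ∫ (L u) exp (r u) dμ`, with no
chain rule. Concavity replaces `EI(Φ)` by its tangent at `ρ r`, namely `Ent(g) ≤ Φ(ρ r) + Φ'(ρ r)
(𝓘(g) - ρ r)`, which is precisely the required sign of the derivative (`entropy_exp_le`).

The analytic input is the backward equation for bounded functions (`hasDerivAt_semigroup`), obtained
from the first jump decomposition, and `M1 ∈ ℓ¹(μ)`, which dominates `L u` and justifies both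
differentiation under the integral and summation by parts. The case `q = ∞` follows by a limit at
each atom. -/

namespace MarkovEI

/-! ### Growth functions and the time change. -/

namespace IsGrowthFunction

variable {Φ : ℝ → ℝ} (hΦ : IsGrowthFunction Φ)
include hΦ

lemma hasDerivAt {r : ℝ} (hr : 0 < r) : HasDerivAt Φ (deriv Φ r) r :=
  ((hΦ.contDiff.contDiffAt (Ioi_mem_nhds hr)).differentiableAt one_ne_zero).hasDerivAt

lemma continuousOn_deriv : ContinuousOn (deriv Φ) (Ioi 0) :=
  hΦ.contDiff.continuousOn_deriv_of_isOpen isOpen_Ioi le_rfl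

lemma le_tangent {r s : ℝ} (hr : 0 < r) (hs : 0 < s) : Φ s ≤ Φ r + deriv Φ r * (s - r) := by
  rcases lt_trichotomy r s with h | rfl | h
  · have := hΦ.concave.slope_le_of_hasDerivAt hr hs h (hΦ.hasDerivAt hr)
    rw [slope_def_field, div_le_iff₀ (sub_pos.2 h)] at this
    linarith
  · simp
  · have := hΦ.concave.le_slope_of_hasDerivAt hs hr h (hΦ.hasDerivAt hr)
    rw [slope_def_field, le_div_iff₀ (sub_pos.2 h)] at this
    linarith

lemma deriv_pos {r : ℝ} (hr : 0 < r) : 0 < deriv Φ r := by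
  have h := hΦ.le_tangent hr (show (0 : ℝ) < r + 1 by linarith)
  have h' := hΦ.strictMono (show r ∈ Ioi 0 from hr) (show r + 1 ∈ Ioi 0 by simp; linarith)
    (by linarith)
  linarith

lemma tendsto_rightLim : Tendsto Φ (𝓝[>] 0) (𝓝 (Function.rightLim Φ 0)) := by
  have hb : BddBelow (Φ '' Ioi 0) := ⟨0, by rintro _ ⟨r, hr, rfl⟩; exact (hΦ.pos r hr).le⟩
  have h := hΦ.strictMono.monotoneOn.tendsto_nhdsGT hb
  rwa [rightLim_eq_of_tendsto h]

/-- The tangent bound passes to the limit `s → 0+`; this endpoint is needed because the Fisher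
information may vanish. -/
lemma growthValue_le {r s : ℝ} (hr : 0 < r) (hs : 0 ≤ s) :
    growthValue Φ s ≤ Φ r + deriv Φ r * (s - r) := by
  rcases hs.eq_or_lt with rfl | hs
  · rw [growthValue, if_pos rfl]
    have h : Tendsto (fun s => Φ r + deriv Φ r * (s - r)) (𝓝[>] 0)
        (𝓝 (Φ r + deriv Φ r * (0 - r))) :=
      (Continuous.tendsto (by fun_prop) 0).mono_left nhdsWithin_le_nhds
    exact le_of_tendsto_of_tendsto hΦ.tendsto_rightLim h
      (eventually_mem_nhdsWithin.mono fun s hs => hΦ.le_tangent hr hs)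
  · rw [growthValue, if_neg hs.ne']
    exact hΦ.le_tangent hr hs

/-- The tangent at `r` lies above `Φ(0) ≥ 0` at the origin. Hence `Φ(ρ r) / r` decreases and `m` has
a limit as `q → ∞`. -/
lemma mul_deriv_le {r : ℝ} (hr : 0 < r) : r * deriv Φ r ≤ Φ r := by
  have h := hΦ.growthValue_le hr le_rfl
  have h0 : 0 ≤ growthValue Φ 0 := by
    rw [growthValue, if_pos rfl]
    exact ge_of_tendsto hΦ.tendsto_rightLim
      (eventually_mem_nhdsWithin.mono fun s hs => (hΦ.pos s hs).le)
  linarith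

lemma hasDerivAt_div {ρ r : ℝ} (hρ : 0 < ρ) (hr : 0 < r) :
    HasDerivAt (fun r => Φ (ρ * r) / r)
      ((ρ * r * deriv Φ (ρ * r) - Φ (ρ * r)) / r ^ 2) r := by
  have h : HasDerivAt (fun r => Φ (ρ * r)) (deriv Φ (ρ * r) * ρ) r :=
    (hΦ.hasDerivAt (mul_pos hρ hr)).comp r (by simpa using (hasDerivAt_id r).const_mul ρ)
  refine (h.fun_div (hasDerivAt_id' r) hr.ne').congr_deriv ?_
  ring

lemma antitoneOn_div {ρ : ℝ} (hρ : 0 < ρ) : AntitoneOn (fun r => Φ (ρ * r) / r) (Ioi 0) := by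
  refine antitoneOn_of_deriv_nonpos (convex_Ioi 0)
    (fun r hr => (hΦ.hasDerivAt_div hρ hr).continuousAt.continuousWithinAt)
    (fun r hr => (hΦ.hasDerivAt_div hρ (by simpa using hr)).differentiableAt.differentiableWithinAt)
    fun r hr => ?_
  rw [interior_Ioi] at hr
  rw [(hΦ.hasDerivAt_div hρ hr).deriv]
  exact div_nonpos_of_nonpos_of_nonneg
    (by linarith [hΦ.mul_deriv_le (mul_pos hρ (show 0 < r from hr))]) (sq_nonneg r)

lemma exists_tendsto_expOf {ρ : ℝ} (hρ : 0 < ρ) (p : ℝ) :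
    ∃ m, Tendsto (fun q => expOf Φ ρ p q) atTop (𝓝 m) := by
  -- Truncating at `1` gives a globally monotone function with the same limit at infinity.
  have hmono : Antitone fun r => Φ (ρ * max 1 r) / max 1 r := fun a b hab =>
    hΦ.antitoneOn_div hρ (show (0 : ℝ) < max 1 a from lt_max_of_lt_left one_pos)
      (show (0 : ℝ) < max 1 b from lt_max_of_lt_left one_pos) (max_le_max le_rfl hab)
  have hb : BddBelow (range fun r => Φ (ρ * max 1 r) / max 1 r) := by
    refine ⟨0, ?_⟩
    rintro _ ⟨r, rfl⟩
    have : 0 < max 1 r := lt_max_of_lt_left one_pos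
    exact (div_pos (hΦ.pos _ (mul_pos hρ this)) this).le
  refine ⟨_, ((tendsto_atTop_ciInf hmono hb).const_sub (Φ (ρ * p) / p)).congr' ?_⟩
  filter_upwards [eventually_ge_atTop 1] with q hq
  rw [expOf, max_eq_right hq]

variable {ρ p : ℝ} (hρ : 0 < ρ)
include hρ

lemma continuousOn_integrand : ContinuousOn (fun r => deriv Φ (ρ * r) / r) (Ioi 0) :=
  (hΦ.continuousOn_deriv.comp (by fun_prop) fun r hr => mul_pos hρ hr).div continuousOn_id
    fun r hr => (show 0 < r from hr).ne'

lemma integrand_pos {r : ℝ} (hr : 0 < r) : 0 < deriv Φ (ρ * r) / r :=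
  div_pos (hΦ.deriv_pos (mul_pos hρ hr)) hr

variable (hp : 0 < p)
include hp

lemma intervalIntegrable_integrand {q : ℝ} (hpq : p ≤ q) :
    IntervalIntegrable (fun r => deriv Φ (ρ * r) / r) volume p q :=
  ((hΦ.continuousOn_integrand hρ).mono fun r hr => hp.trans_le
    (by rw [uIcc_of_le hpq] at hr; exact hr.1)).intervalIntegrable

lemma hasDerivAt_timeOf {r : ℝ} (hr : p ≤ r) :
    HasDerivAt (fun r => timeOf Φ ρ p r) (deriv Φ (ρ * r) / r) r := by
  have hc := hΦ.continuousOn_integrand hρ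
  exact intervalIntegral.integral_hasDerivAt_right (hΦ.intervalIntegrable_integrand hρ hp hr)
    (hc.stronglyMeasurableAtFilter isOpen_Ioi r (hp.trans_le hr))
    (hc.continuousAt (Ioi_mem_nhds (hp.trans_le hr)))

lemma strictMonoOn_timeOf : StrictMonoOn (fun r => timeOf Φ ρ p r) (Ici p) := by
  refine strictMonoOn_of_deriv_pos (convex_Ici p)
    (fun r hr => (hΦ.hasDerivAt_timeOf hρ hp hr).continuousAt.continuousWithinAt) fun r hr => ?_
  rw [interior_Ici] at hr
  rw [(hΦ.hasDerivAt_timeOf hρ hp (le_of_lt hr)).deriv]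
  exact hΦ.integrand_pos hρ (hp.trans hr)

lemma timeOf_pos {r : ℝ} (hr : p < r) : 0 < timeOf Φ ρ p r := by
  simpa [timeOf] using hΦ.strictMonoOn_timeOf hρ hp self_mem_Ici (le_of_lt hr) hr

lemma timeOf_nonneg {r : ℝ} (hr : p ≤ r) : 0 ≤ timeOf Φ ρ p r := by
  rcases hr.eq_or_lt with rfl | hr
  · simp [timeOf]
  · exact (hΦ.timeOf_pos hρ hp hr).le

/-- The measure `dr / r` is invariant under scaling, so `ρ` only moves the lower endpoint, and the
integrand is continuous on compact subsets of `(0, ∞)`. -/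
lemma integrableOn_integrand_iff :
    IntegrableOn (fun r => deriv Φ (ρ * r) / r) (Ioi p) ↔
      IntegrableAtFilter (fun r => deriv Φ r / r) atTop := by
  have key : IntegrableOn (fun r => deriv Φ (ρ * r) / r) (Ioi p) ↔
      IntegrableOn (fun r => deriv Φ r / r) (Ioi (ρ * p)) := by
    rw [← integrableOn_Ioi_comp_mul_left_iff _ p hρ]
    have : (fun r => deriv Φ (ρ * r) / r) = fun r => ρ * (deriv Φ (ρ * r) / (ρ * r)) := by
      ext r
      rw [mul_div_assoc', mul_div_mul_left _ _ hρ.ne']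
    rw [this]
    exact integrable_const_mul_iff (isUnit_iff_ne_zero.2 hρ.ne') _
  rw [key]
  refine ⟨fun h => ⟨_, Ioi_mem_atTop _, h⟩, fun ⟨s, hs, h⟩ => ?_⟩
  obtain ⟨a, ha⟩ := mem_atTop_sets.1 hs
  have hlt : ρ * p ≤ max (ρ * p) a := le_max_left _ _
  rw [← Ioc_union_Ioi_eq_Ioi hlt]
  refine IntegrableOn.union ?_ (h.mono_set fun r hr => ha r ((le_max_right _ _).trans (le_of_lt hr)))
  have := hΦ.intervalIntegrable_integrand one_pos (mul_pos hρ hp) hlt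
  simp only [one_mul] at this
  exact (intervalIntegrable_iff_integrableOn_Ioc_of_le hlt).1 this

lemma exists_tendsto_timeOf (h : IntegrableAtFilter (fun r => deriv Φ r / r) atTop) :
    ∃ t, Tendsto (fun q => timeOf Φ ρ p q) atTop (𝓝 t) :=
  ⟨_, intervalIntegral_tendsto_integral_Ioi p ((hΦ.integrableOn_integrand_iff hρ hp).2 h)
    tendsto_id⟩

/-- A monotone function diverges or converges; as the integrand is positive, convergence would bound
the integrals of its norm and make it integrable. -/
lemma tendsto_timeOf_atTop (h : ¬ IntegrableAtFilter (fun r => deriv Φ r / r) atTop) :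
    Tendsto (fun q => timeOf Φ ρ p q) atTop atTop := by
  have hmono : Monotone fun q => timeOf Φ ρ p (max p q) := fun a b hab =>
    (hΦ.strictMonoOn_timeOf hρ hp).monotoneOn (le_max_left p a) (le_max_left p b)
      (max_le_max le_rfl hab)
  have hev : (fun q => timeOf Φ ρ p (max p q)) =ᶠ[atTop] fun q => timeOf Φ ρ p q := by
    filter_upwards [eventually_ge_atTop p] with q hq
    rw [max_eq_right hq]
  rcases tendsto_atTop_of_monotone hmono with hlim | ⟨l, hl⟩
  · exact hlim.congr' hev
  · refine absurd ((hΦ.integrableOn_integrand_iff hρ hp).1 ?_) h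
    refine integrableOn_Ioi_of_intervalIntegral_norm_bounded (l := atTop)
      (b := fun q => max p q) l p
      (fun q => (intervalIntegrable_iff_integrableOn_Ioc_of_le (le_max_left p q)).1
        (hΦ.intervalIntegrable_integrand hρ hp (le_max_left p q)))
      (tendsto_atTop_mono (fun q => le_max_right p q) tendsto_id)
      (Eventually.of_forall fun q => ?_)
    have : ∫ r in p..max p q, ‖deriv Φ (ρ * r) / r‖ = timeOf Φ ρ p (max p q) :=
      intervalIntegral.integral_congr fun r hr => by
        rw [uIcc_of_le (le_max_left p q)] at hr
        exact Real.norm_of_nonneg (hΦ.integrand_pos hρ (hp.trans_le hr.1)).le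
    rw [this]
    exact hmono.ge_of_tendsto hl q

end IsGrowthFunction

end MarkovEI

/-! ### The minimal chain: total mass and first jump decomposition. -/

namespace MarkovEI

variable {X : Type*} {k : X → X → ℝ}

/-- The semigroup acting on nonnegative functions, with values in `[0,∞]`. -/
noncomputable def lsemigroup (k : X → X → ℝ) (t : ℝ) (g : X → ℝ≥0∞) (x : X) : ℝ≥0∞ :=
  ∑' y, transitionProb k t x y * g y

lemma M1_nonneg (hk : IsRateMatrix k) (x : X) : 0 ≤ M1 k x :=
  tsum_nonneg fun y => hk.nonneg _ _ y.2.symm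

lemma summable_offDiag (hk : IsRateMatrix k) (x : X) :
    Summable fun y : {y : X // y ≠ x} => k x y :=
  (hk.rowSum x).summable.subtype {y | y ≠ x}

lemma tsum_ofReal_offDiag (hk : IsRateMatrix k) (x : X) :
    ∑' y : {y : X // y ≠ x}, ENNReal.ofReal (k x y) = ENNReal.ofReal (M1 k x) :=
  (ENNReal.ofReal_tsum_of_nonneg (fun y => hk.nonneg _ _ y.2.symm) (summable_offDiag hk x)).symm

section countable

variable [Countable X]

lemma measurable_jumpProb (n : ℕ) (x y : X) : Measurable fun t => jumpProb k n t x y := by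
  induction n generalizing x y with
  | zero =>
    simp only [jumpProb]
    split_ifs
    · fun_prop
    · fun_prop
  | succ n ih =>
    simp only [jumpProb]
    -- The time occurs both in the domain and in the integrand, so joint measurability in `(t, s)`
    -- is shown with the domain written as an indicator.
    have h : Measurable fun p : ℝ × ℝ =>
        ({p : ℝ × ℝ | 0 < p.2 ∧ p.2 ≤ p.1}.indicator fun p =>
          ENNReal.ofReal (Real.exp (-(M1 k x * p.2))) *
          ∑' z : {z : X // z ≠ x}, ENNReal.ofReal (k x z) * jumpProb k n (p.1 - p.2) z y) p := by
      refine Measurable.indicator ?_ ?_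
      · refine Measurable.mul (by fun_prop) (Measurable.tsum fun z => ?_)
        exact ((ih z y).comp (measurable_fst.sub measurable_snd)).const_mul _
      · exact (measurableSet_lt measurable_const measurable_snd).inter
          (measurableSet_le measurable_snd measurable_fst)
    convert h.lintegral_prod_right' (ν := volume) using 2 with t
    rw [← lintegral_indicator measurableSet_Ioc]
    rfl

lemma measurable_jumpIntegrand (k : X → X → ℝ) (n : ℕ) (t : ℝ) (x y : X) :
    Measurable fun s : ℝ => ENNReal.ofReal (Real.exp (-(M1 k x * s))) *
      ∑' z : {z : X // z ≠ x}, ENNReal.ofReal (k x z) * jumpProb k n (t - s) z y := by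
  refine Measurable.mul (by fun_prop) (Measurable.tsum fun z => Measurable.const_mul ?_ _)
  exact (measurable_jumpProb n (z : X) y).comp (measurable_const.sub measurable_id)

/-- The probability of performing fewer than `N` jumps is at most one. -/
lemma sum_jumpProb_le_one (hk : IsRateMatrix k) (N : ℕ) {t : ℝ} (ht : 0 ≤ t) (x : X) :
    ∑' y, ∑ n ∈ Finset.range N, jumpProb k n t x y ≤ 1 := by
  classical
  induction N generalizing t x with
  | zero => simp
  | succ N ih =>
    have h0 : ∑' y, jumpProb k 0 t x y = ENNReal.ofReal (Real.exp (-(M1 k x * t))) := by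
      simp only [jumpProb]
      convert tsum_ite_eq x (fun _ => ENNReal.ofReal (Real.exp (-(M1 k x * t)))) using 3 with y
      simp only [eq_comm]
    have h1 : ∑' y, ∑ n ∈ Finset.range N, jumpProb k (n + 1) t x y
        = ∫⁻ s in Ioc 0 t, ENNReal.ofReal (Real.exp (-(M1 k x * s))) *
          ∑' z : {z : X // z ≠ x}, ENNReal.ofReal (k x z) *
            ∑' y, ∑ n ∈ Finset.range N, jumpProb k n (t - s) z y := by
      simp only [jumpProb]
      have (y : X) : ∑ n ∈ Finset.range N, ∫⁻ s in Ioc 0 t,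
          ENNReal.ofReal (Real.exp (-(M1 k x * s))) *
            ∑' z : {z : X // z ≠ x}, ENNReal.ofReal (k x z) * jumpProb k n (t - s) z y
          = ∫⁻ s in Ioc 0 t, ∑ n ∈ Finset.range N,
          ENNReal.ofReal (Real.exp (-(M1 k x * s))) *
            ∑' z : {z : X // z ≠ x}, ENNReal.ofReal (k x z) * jumpProb k n (t - s) z y := by
        rw [lintegral_finsetSum _ fun n _ => measurable_jumpIntegrand k n t x y]
      simp_rw [this]
      rw [← lintegral_tsum]
      · refine lintegral_congr fun s => ?_
        simp_rw [← Finset.mul_sum, ENNReal.tsum_mul_left]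
        congr 1
        simp_rw [← ENNReal.tsum_mul_left]
        rw [ENNReal.tsum_comm]
        refine tsum_congr fun y => ?_
        rw [← Summable.tsum_finsetSum fun _ _ => ENNReal.summable]
        simp_rw [Finset.mul_sum]
      · exact fun y => (Finset.measurable_sum _ fun n _ =>
          measurable_jumpIntegrand k n t x y).aemeasurable
    simp_rw [Finset.sum_range_succ']
    rw [ENNReal.tsum_add, h0, h1]
    have hM := M1_nonneg hk x
    have hint : ∫ s in (0 : ℝ)..t, Real.exp (-(M1 k x * s)) * M1 k x
        = 1 - Real.exp (-(M1 k x * t)) := by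
      have hd (s : ℝ) : HasDerivAt (fun s => -Real.exp (-(M1 k x * s)))
          (Real.exp (-(M1 k x * s)) * M1 k x) s := by
        refine (((hasDerivAt_id' s).const_mul (M1 k x)).fun_neg.exp).fun_neg.congr_deriv ?_
        ring
      rw [intervalIntegral.integral_eq_sub_of_hasDerivAt (fun s _ => hd s)
        (Continuous.intervalIntegrable (by fun_prop) _ _)]
      simp
      ring
    -- After the first jump the remaining mass is at most one by induction; what is left is the
    -- probability of a jump before `t`.
    have hle : ∫⁻ s in Ioc 0 t, ENNReal.ofReal (Real.exp (-(M1 k x * s))) *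
          ∑' z : {z : X // z ≠ x}, ENNReal.ofReal (k x z) *
            ∑' y, ∑ n ∈ Finset.range N, jumpProb k n (t - s) z y
        ≤ ENNReal.ofReal (1 - Real.exp (-(M1 k x * t))) := by
      rw [← hint, intervalIntegral.integral_of_le ht, ofReal_integral_eq_lintegral_ofReal]
      · refine setLIntegral_mono' measurableSet_Ioc fun s hs => ?_
        rw [ENNReal.ofReal_mul (Real.exp_nonneg _), ← tsum_ofReal_offDiag hk]
        gcongr with z
        exact mul_le_of_le_one_right' (ih (by linarith [hs.2]) z)
      · exact (Continuous.intervalIntegrable (by fun_prop) 0 t).1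
      · exact Eventually.of_forall fun s => mul_nonneg (Real.exp_nonneg _) hM
    refine (add_le_add_left hle _).trans ?_
    have hexp : Real.exp (-(M1 k x * t)) ≤ 1 := Real.exp_le_one_iff.2 (by nlinarith)
    rw [← ENNReal.ofReal_add (by linarith) (Real.exp_nonneg _)]
    simp

lemma tsum_transitionProb_le_one (hk : IsRateMatrix k) {t : ℝ} (ht : 0 ≤ t) (x : X) :
    ∑' y, transitionProb k t x y ≤ 1 := by
  have : ∑' y, transitionProb k t x y = ∑' n, ∑' y, jumpProb k n t x y := by
    simp only [transitionProb]
    exact ENNReal.tsum_comm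
  rw [this]
  refine ENNReal.tsum_le_of_sum_range_le fun N => ?_
  rw [← Summable.tsum_finsetSum fun _ _ => ENNReal.summable]
  exact sum_jumpProb_le_one hk N ht x

/-- First jump decomposition. -/
lemma lsemigroup_eq (g : X → ℝ≥0∞) (t : ℝ) (x : X) :
    lsemigroup k t g x = ENNReal.ofReal (Real.exp (-(M1 k x * t))) * g x +
      ∫⁻ s in Ioc 0 t, ENNReal.ofReal (Real.exp (-(M1 k x * s))) *
        ∑' z : {z : X // z ≠ x}, ENNReal.ofReal (k x z) * lsemigroup k (t - s) g z := by
  classical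
  have hsplit (y : X) : transitionProb k t x y * g y
      = jumpProb k 0 t x y * g y + (∑' n, jumpProb k (n + 1) t x y) * g y := by
    rw [← add_mul, transitionProb, tsum_eq_zero_add' ENNReal.summable]
  rw [lsemigroup]
  simp_rw [hsplit]
  rw [ENNReal.tsum_add]
  congr 1
  · rw [tsum_eq_single x fun y hy => by simp [jumpProb, hy.symm]]
    simp [jumpProb]
  · simp only [jumpProb]
    have (y : X) : (∑' n, ∫⁻ s in Ioc 0 t, ENNReal.ofReal (Real.exp (-(M1 k x * s))) *
          ∑' z : {z : X // z ≠ x}, ENNReal.ofReal (k x z) * jumpProb k n (t - s) z y) * g y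
        = ∫⁻ s in Ioc 0 t, (∑' n, ENNReal.ofReal (Real.exp (-(M1 k x * s))) *
          ∑' z : {z : X // z ≠ x}, ENNReal.ofReal (k x z) * jumpProb k n (t - s) z y) * g y := by
      rw [lintegral_mul_const _ (Measurable.tsum fun n => measurable_jumpIntegrand k n t x y),
        lintegral_tsum fun n => (measurable_jumpIntegrand k n t x y).aemeasurable]
    simp_rw [this]
    rw [← lintegral_tsum fun y =>
      ((Measurable.tsum fun n => measurable_jumpIntegrand k n t x y).mul_const _).aemeasurable]
    refine lintegral_congr fun s => ?_
    simp_rw [ENNReal.tsum_mul_left, mul_assoc, ENNReal.tsum_mul_left]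
    congr 1
    have h (y : X) : (∑' n, ∑' z : {z : X // z ≠ x},
          ENNReal.ofReal (k x z) * jumpProb k n (t - s) z y) * g y
        = ∑' z : {z : X // z ≠ x},
          ENNReal.ofReal (k x z) * (transitionProb k (t - s) z y * g y) := by
      rw [ENNReal.tsum_comm, ← ENNReal.tsum_mul_right]
      refine tsum_congr fun z => ?_
      rw [ENNReal.tsum_mul_left, mul_assoc, transitionProb]
    simp_rw [h]
    rw [ENNReal.tsum_comm]
    simp_rw [ENNReal.tsum_mul_left, lsemigroup]

end countable

end MarkovEI

/-! ### The semigroup on bounded functions and the backward equation. -/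

namespace MarkovEI

variable {X : Type*} {k : X → X → ℝ}

lemma tsum_eq_add_tsum_ne {F : X → ℝ} (hF : Summable F) (x : X) :
    ∑' y, F y = F x + ∑' y : {y : X // y ≠ x}, F y := by
  have h := hF.tsum_subtype_add_tsum_subtype_compl {x}
  rw [tsum_singleton x F] at h
  exact h.symm

lemma rate_self (hk : IsRateMatrix k) (x : X) : k x x = -M1 k x := by
  have h := tsum_eq_add_tsum_ne (hk.rowSum x).summable x
  rw [(hk.rowSum x).tsum_eq] at h
  rw [M1]
  linarith

lemma summable_rate_mul (hk : IsRateMatrix k) (x : X) {u : X → ℝ} {C : ℝ} (hu : ∀ y, |u y| ≤ C) :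
    Summable fun y => k x y * u y :=
  ((hk.rowSum x).summable.abs.mul_right C).of_norm_bounded fun y => by
    rw [Real.norm_eq_abs, abs_mul]
    exact mul_le_mul_of_nonneg_left (hu y) (abs_nonneg _)

lemma tsum_rate_mul (hk : IsRateMatrix k) (x : X) {u : X → ℝ} {C : ℝ} (hu : ∀ y, |u y| ≤ C) :
    ∑' y, k x y * u y = ∑' y : {y : X // y ≠ x}, k x y * u y - M1 k x * u x := by
  rw [tsum_eq_add_tsum_ne (summable_rate_mul hk x hu) x, rate_self hk]
  ring

lemma abs_tsum_offDiag_le (hk : IsRateMatrix k) (x : X) {u : X → ℝ} {C : ℝ}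
    (hu : ∀ y, |u y| ≤ C) : |∑' y : {y : X // y ≠ x}, k x y * u y| ≤ M1 k x * C := by
  rw [← Real.norm_eq_abs]
  refine tsum_of_norm_bounded ((summable_offDiag hk x).hasSum.mul_right C) fun y => ?_
  rw [Real.norm_eq_abs, abs_mul, abs_of_nonneg (hk.nonneg _ _ y.2.symm)]
  exact mul_le_mul_of_nonneg_left (hu y) (hk.nonneg _ _ y.2.symm)

lemma abs_tsum_rate_mul_le (hk : IsRateMatrix k) (x : X) {u : X → ℝ} {C : ℝ}
    (hu : ∀ y, |u y| ≤ C) : |∑' y, k x y * u y| ≤ 2 * C * M1 k x := by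
  have h1 := abs_tsum_offDiag_le hk x hu
  have h2 : |M1 k x * u x| ≤ M1 k x * C := by
    rw [abs_mul, abs_of_nonneg (M1_nonneg hk x)]
    exact mul_le_mul_of_nonneg_left (hu x) (M1_nonneg hk x)
  rw [tsum_rate_mul hk x hu]
  exact (abs_sub _ _).trans (by linarith)

lemma semigroup_nonneg {g : X → ℝ} (hg : ∀ y, 0 ≤ g y) (t : ℝ) (x : X) :
    0 ≤ semigroup k t g x :=
  tsum_nonneg fun y => mul_nonneg ENNReal.toReal_nonneg (hg y)

lemma semigroup_zero (f : X → ℝ) : semigroup k 0 f = f := by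
  ext x
  have h (y : X) : transitionProb k 0 x y = jumpProb k 0 0 x y := by
    rw [transitionProb, tsum_eq_zero_add' ENNReal.summable]
    simp [jumpProb]
  rw [semigroup, tsum_eq_single x fun y hy => by rw [h]; simp [jumpProb, hy.symm], h]
  simp [jumpProb]

lemma abs_posPart_le {f : X → ℝ} {C : ℝ} (hf : ∀ y, |f y| ≤ C) (y : X) : |max (f y) 0| ≤ C := by
  rw [abs_of_nonneg (le_max_right _ _)]
  exact max_le ((le_abs_self _).trans (hf y)) ((abs_nonneg _).trans (hf y))

lemma abs_negPart_le {f : X → ℝ} {C : ℝ} (hf : ∀ y, |f y| ≤ C) (y : X) : |max (-f y) 0| ≤ C := by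
  rw [abs_of_nonneg (le_max_right _ _)]
  exact max_le ((neg_le_abs _).trans (hf y)) ((abs_nonneg _).trans (hf y))

variable [Countable X]

lemma summable_transitionProb (hk : IsRateMatrix k) {t : ℝ} (ht : 0 ≤ t) (x : X) :
    Summable fun y => (transitionProb k t x y).toReal :=
  ENNReal.summable_toReal ((tsum_transitionProb_le_one hk ht x).trans_lt ENNReal.one_lt_top).ne

lemma transitionProb_ne_top (hk : IsRateMatrix k) {t : ℝ} (ht : 0 ≤ t) (x y : X) :
    transitionProb k t x y ≠ ∞ :=
  ((ENNReal.le_tsum y).trans_lt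
    ((tsum_transitionProb_le_one hk ht x).trans_lt ENNReal.one_lt_top)).ne

lemma summable_transitionProb_mul (hk : IsRateMatrix k) {t : ℝ} (ht : 0 ≤ t) (x : X) {f : X → ℝ}
    {C : ℝ} (hf : ∀ y, |f y| ≤ C) : Summable fun y => (transitionProb k t x y).toReal * f y :=
  ((summable_transitionProb hk ht x).mul_right C).of_norm_bounded fun y => by
    rw [Real.norm_eq_abs, abs_mul, ENNReal.abs_toReal]
    exact mul_le_mul_of_nonneg_left (hf y) ENNReal.toReal_nonneg

lemma abs_semigroup_le (hk : IsRateMatrix k) {f : X → ℝ} {C : ℝ} (hf : ∀ y, |f y| ≤ C) {t : ℝ}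
    (ht : 0 ≤ t) (x : X) : |semigroup k t f x| ≤ C := by
  have h1 : ∑' y, (transitionProb k t x y).toReal ≤ 1 := by
    rw [← ENNReal.tsum_toReal_eq (transitionProb_ne_top hk ht x)]
    exact ENNReal.toReal_le_of_le_ofReal zero_le_one
      (by simpa using tsum_transitionProb_le_one hk ht x)
  have hC : 0 ≤ C := (abs_nonneg _).trans (hf x)
  rw [← Real.norm_eq_abs, semigroup]
  refine (tsum_of_norm_bounded ((summable_transitionProb hk ht x).hasSum.mul_right C)
    fun y => ?_).trans (mul_le_of_le_one_left hC h1)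
  rw [Real.norm_eq_abs, abs_mul, ENNReal.abs_toReal]
  exact mul_le_mul_of_nonneg_left (hf y) ENNReal.toReal_nonneg

lemma semigroup_sub (hk : IsRateMatrix k) {f g : X → ℝ} {C D : ℝ} (hf : ∀ y, |f y| ≤ C)
    (hg : ∀ y, |g y| ≤ D) {t : ℝ} (ht : 0 ≤ t) (x : X) :
    semigroup k t (fun y => f y - g y) x = semigroup k t f x - semigroup k t g x := by
  simp only [semigroup, mul_sub]
  exact (summable_transitionProb_mul hk ht x hf).tsum_sub (summable_transitionProb_mul hk ht x hg)

lemma measurable_semigroup (f : X → ℝ) (x : X) : Measurable fun t => semigroup k t f x :=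
  Measurable.tsum fun y => (Measurable.tsum fun n =>
    measurable_jumpProb n x y).ennreal_toReal.mul_const _

lemma measurable_tsum_offDiag_semigroup (k : X → X → ℝ) (f : X → ℝ) (x : X) :
    Measurable fun t => ∑' z : {z : X // z ≠ x}, k x z * semigroup k t f z :=
  Measurable.tsum fun z => (measurable_semigroup f z.1).const_mul _

lemma ofReal_semigroup (hk : IsRateMatrix k) {g : X → ℝ} {C : ℝ} (hg : ∀ y, 0 ≤ g y)
    (hgC : ∀ y, |g y| ≤ C) {t : ℝ} (ht : 0 ≤ t) (x : X) :
    ENNReal.ofReal (semigroup k t g x) = lsemigroup k t (fun y => ENNReal.ofReal (g y)) x := by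
  rw [semigroup, ENNReal.ofReal_tsum_of_nonneg
    (fun y => mul_nonneg ENNReal.toReal_nonneg (hg y)) (summable_transitionProb_mul hk ht x hgC)]
  refine tsum_congr fun y => ?_
  rw [ENNReal.ofReal_mul ENNReal.toReal_nonneg,
    ENNReal.ofReal_toReal (transitionProb_ne_top hk ht x y)]

/-- First jump decomposition of the semigroup, for nonnegative functions. -/
lemma semigroup_eq_of_nonneg (hk : IsRateMatrix k) {g : X → ℝ} {C : ℝ} (hg : ∀ y, 0 ≤ g y)
    (hgC : ∀ y, |g y| ≤ C) {t : ℝ} (ht : 0 ≤ t) (x : X) :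
    semigroup k t g x = Real.exp (-(M1 k x * t)) * (g x + ∫ s in (0 : ℝ)..t,
      Real.exp (M1 k x * s) * ∑' z : {z : X // z ≠ x}, k x z * semigroup k s g z) := by
  set W : ℝ → ℝ := fun s => ∑' z : {z : X // z ≠ x}, k x z * semigroup k s g z with hW
  have hW0 (s : ℝ) : 0 ≤ W s := tsum_nonneg fun z =>
    mul_nonneg (hk.nonneg _ _ z.2.symm) (semigroup_nonneg hg s z)
  have hWm : Measurable W := measurable_tsum_offDiag_semigroup k g x
  have hWl {s : ℝ} (hs : 0 ≤ s) : ENNReal.ofReal (W s) = ∑' z : {z : X // z ≠ x},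
      ENNReal.ofReal (k x z) * lsemigroup k s (fun y => ENNReal.ofReal (g y)) z := by
    rw [hW, ENNReal.ofReal_tsum_of_nonneg
      (fun z : {z : X // z ≠ x} => mul_nonneg (hk.nonneg _ _ z.2.symm) (semigroup_nonneg hg s z))
      ((summable_rate_mul hk x (abs_semigroup_le hk hgC hs)).subtype {z | z ≠ x})]
    refine tsum_congr fun z => ?_
    rw [ENNReal.ofReal_mul (hk.nonneg _ _ z.2.symm), ofReal_semigroup hk hg hgC hs]
  -- Reversing time by `s ↦ t - s` removes `t` from the integrand, so that the formula can be
  -- differentiated in `t`.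
  have hint : ∫ s in (0 : ℝ)..t, Real.exp (M1 k x * s) * W s
      = Real.exp (M1 k x * t) * ∫ s in (0 : ℝ)..t, Real.exp (-(M1 k x * s)) * W (t - s) := by
    have h := intervalIntegral.integral_comp_sub_left (a := 0) (b := t)
      (fun s => Real.exp (-(M1 k x * (t - s))) * W s) t
    simp only [sub_sub_cancel, sub_self, sub_zero] at h
    rw [h, ← intervalIntegral.integral_const_mul]
    refine intervalIntegral.integral_congr fun s _ => ?_
    rw [← mul_assoc, ← Real.exp_add]
    ring_nf
  have hlint : ∫⁻ s in Ioc 0 t, ENNReal.ofReal (Real.exp (-(M1 k x * s))) *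
        ∑' z : {z : X // z ≠ x}, ENNReal.ofReal (k x z) *
          lsemigroup k (t - s) (fun y => ENNReal.ofReal (g y)) z
      = ∫⁻ s in Ioc 0 t, ENNReal.ofReal (Real.exp (-(M1 k x * s)) * W (t - s)) :=
    setLIntegral_congr_fun measurableSet_Ioc fun s hs => by
      rw [ENNReal.ofReal_mul (Real.exp_nonneg _), hWl (by linarith [hs.2])]
  -- The integral is a summand of the finite number `semigroup k t g x`.
  have hfin : ∫⁻ s in Ioc 0 t, ENNReal.ofReal (Real.exp (-(M1 k x * s)) * W (t - s)) ≠ ∞ := by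
    have h := lsemigroup_eq (k := k) (fun y => ENNReal.ofReal (g y)) t x
    rw [← ofReal_semigroup hk hg hgC ht, hlint] at h
    exact fun htop => by simp [htop] at h
  have h := lsemigroup_eq (k := k) (fun y => ENNReal.ofReal (g y)) t x
  rw [← ofReal_semigroup hk hg hgC ht, hlint, ← ENNReal.ofReal_mul (Real.exp_nonneg _)] at h
  have h' := congrArg ENNReal.toReal h
  rw [ENNReal.toReal_add ENNReal.ofReal_ne_top hfin,
    ENNReal.toReal_ofReal (semigroup_nonneg hg t x),
    ENNReal.toReal_ofReal (mul_nonneg (Real.exp_nonneg _) (hg x)),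
    ← integral_eq_lintegral_of_nonneg_ae
      (Eventually.of_forall fun s => mul_nonneg (Real.exp_nonneg _) (hW0 _))
      ((by fun_prop : Measurable fun s => Real.exp (-(M1 k x * s)) * W (t - s))).aestronglyMeasurable,
    ← intervalIntegral.integral_of_le ht] at h'
  rw [h', hint, mul_add, ← mul_assoc (Real.exp (-(M1 k x * t))), ← Real.exp_add]
  simp

/-- The integral equation has a locally bounded measurable integrand, and its primitive is
continuous. -/
lemma continuousOn_of_nonneg (hk : IsRateMatrix k) {g : X → ℝ} {C : ℝ} (hg : ∀ y, 0 ≤ g y)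
    (hgC : ∀ y, |g y| ≤ C) (x : X) : ContinuousOn (fun t => semigroup k t g x) (Ici 0) := by
  have hint (b : ℝ) : IntegrableOn (fun s => Real.exp (M1 k x * s) *
      ∑' z : {z : X // z ≠ x}, k x z * semigroup k s g z) (Icc 0 b) := by
    refine Measure.integrableOn_of_bounded (M := Real.exp (M1 k x * b) * (M1 k x * C))
      (by simp) ?_ ?_
    · exact (Measurable.mul (by fun_prop)
        (measurable_tsum_offDiag_semigroup k g x)).aestronglyMeasurable
    · refine (ae_restrict_iff' measurableSet_Icc).2 (Eventually.of_forall fun s hs => ?_)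
      rw [norm_mul, Real.norm_of_nonneg (Real.exp_nonneg _)]
      have hM := M1_nonneg hk x
      refine mul_le_mul (Real.exp_le_exp.2 (mul_le_mul_of_nonneg_left hs.2 hM))
        ?_ (norm_nonneg _) (Real.exp_nonneg _)
      exact abs_tsum_offDiag_le hk x (abs_semigroup_le hk hgC hs.1)
  intro t ht
  have ht' : (0 : ℝ) ≤ t := ht
  have hc : ContinuousOn (fun t => Real.exp (-(M1 k x * t)) * (g x + ∫ s in (0 : ℝ)..t,
      Real.exp (M1 k x * s) * ∑' z : {z : X // z ≠ x}, k x z * semigroup k s g z))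
      (Icc 0 (t + 1)) := by
    refine ContinuousOn.mul (by fun_prop) (continuousOn_const.add ?_)
    have h01 : (0 : ℝ) ≤ t + 1 := by linarith
    have := intervalIntegral.continuousOn_primitive_interval (μ := volume) (a := 0) (b := t + 1)
      (by rw [uIcc_of_le h01]; exact hint (t + 1))
    rwa [uIcc_of_le h01] at this
  have hc' : ContinuousOn (fun t => semigroup k t g x) (Icc 0 (t + 1)) :=
    hc.congr fun s hs => semigroup_eq_of_nonneg hk hg hgC hs.1 x
  refine (hc' t ⟨ht', by linarith⟩).mono_of_mem_nhdsWithin ?_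
  filter_upwards [self_mem_nhdsWithin,
    mem_nhdsWithin_of_mem_nhds (Iio_mem_nhds (lt_add_one t))] with s hs hs'
  exact ⟨hs, le_of_lt hs'⟩

/-- Bootstrap: continuity at every state, summed with the majorant `k x z * C`, makes the integrand
continuous, so the fundamental theorem of calculus applies. -/
lemma hasDerivAt_of_nonneg (hk : IsRateMatrix k) {g : X → ℝ} {C : ℝ} (hg : ∀ y, 0 ≤ g y)
    (hgC : ∀ y, |g y| ≤ C) {t : ℝ} (ht : 0 < t) (x : X) :
    HasDerivAt (fun t => semigroup k t g x) (∑' y, k x y * semigroup k t g y) t := by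
  set W : ℝ → ℝ := fun s => ∑' z : {z : X // z ≠ x}, k x z * semigroup k s g z with hW
  have hWc : ContinuousOn W (Ici 0) := by
    refine continuousOn_tsum (fun z => continuousOn_const.mul (continuousOn_of_nonneg hk hg hgC z.1))
      ((summable_offDiag hk x).mul_right C) fun z s hs => ?_
    rw [Real.norm_eq_abs, abs_mul, abs_of_nonneg (hk.nonneg _ _ z.2.symm)]
    exact mul_le_mul_of_nonneg_left (abs_semigroup_le hk hgC hs _) (hk.nonneg _ _ z.2.symm)
  have hF : ContinuousOn (fun s => Real.exp (M1 k x * s) * W s) (Ici 0) :=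
    ContinuousOn.mul (by fun_prop) hWc
  have hd : HasDerivAt (fun t => ∫ s in (0 : ℝ)..t, Real.exp (M1 k x * s) * W s)
      (Real.exp (M1 k x * t) * W t) t := by
    refine intervalIntegral.integral_hasDerivAt_right ?_
      ((hF.mono Ioi_subset_Ici_self).stronglyMeasurableAtFilter isOpen_Ioi t ht)
      (hF.continuousAt (Ici_mem_nhds ht))
    refine (hF.mono fun s hs => ?_).intervalIntegrable
    rw [uIcc_of_le ht.le] at hs
    exact hs.1
  have he : HasDerivAt (fun t => Real.exp (-(M1 k x * t)))
      (-M1 k x * Real.exp (-(M1 k x * t))) t := by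
    refine ((hasDerivAt_id' t).const_mul (M1 k x)).fun_neg.exp.congr_deriv ?_
    ring
  have hcongr : (fun t => semigroup k t g x) =ᶠ[𝓝 t] fun t => Real.exp (-(M1 k x * t)) *
      (g x + ∫ s in (0 : ℝ)..t, Real.exp (M1 k x * s) * W s) := by
    filter_upwards [Ioi_mem_nhds ht] with s hs
    exact semigroup_eq_of_nonneg hk hg hgC (le_of_lt hs) x
  refine ((he.fun_mul (hd.const_add (g x))).congr_of_eventuallyEq hcongr).congr_deriv ?_
  rw [tsum_rate_mul hk x (abs_semigroup_le hk hgC ht.le), mul_assoc, ← hcongr.eq_of_nhds,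
    ← mul_assoc, ← Real.exp_add]
  simp
  ring

section bounded

variable (hk : IsRateMatrix k) {f : X → ℝ} {C : ℝ} (hf : ∀ y, |f y| ≤ C)
include hk hf

lemma semigroup_eq_posPart_sub_negPart {t : ℝ} (ht : 0 ≤ t) (x : X) : semigroup k t f x
    = semigroup k t (fun y => max (f y) 0) x - semigroup k t (fun y => max (-f y) 0) x := by
  rw [← semigroup_sub hk (abs_posPart_le hf) (abs_negPart_le hf) ht]
  congr 1
  ext y
  exact (posPart_sub_negPart (f y)).symm

lemma continuousOn_semigroup (x : X) : ContinuousOn (fun t => semigroup k t f x) (Ici 0) :=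
  ((continuousOn_of_nonneg hk (fun _ => le_max_right _ _) (abs_posPart_le hf) x).sub
    (continuousOn_of_nonneg hk (fun _ => le_max_right _ _) (abs_negPart_le hf) x)).congr
    fun _ ht => semigroup_eq_posPart_sub_negPart hk hf ht x

/-- Kolmogorov's backward equation. -/
lemma hasDerivAt_semigroup {t : ℝ} (ht : 0 < t) (x : X) :
    HasDerivAt (fun t => semigroup k t f x) (∑' y, k x y * semigroup k t f y) t := by
  have hp := hasDerivAt_of_nonneg hk (fun _ => le_max_right _ _) (abs_posPart_le hf) ht x
  have hn := hasDerivAt_of_nonneg hk (fun _ => le_max_right _ _) (abs_negPart_le hf) ht x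
  refine ((hp.fun_sub hn).congr_of_eventuallyEq ?_).congr_deriv ?_
  · filter_upwards [Ioi_mem_nhds ht] with s hs
    exact semigroup_eq_posPart_sub_negPart hk hf (le_of_lt hs) x
  · rw [← (summable_rate_mul hk x (abs_semigroup_le hk (abs_posPart_le hf) ht.le)).tsum_sub
      (summable_rate_mul hk x (abs_semigroup_le hk (abs_negPart_le hf) ht.le))]
    refine tsum_congr fun y => ?_
    rw [semigroup_eq_posPart_sub_negPart hk hf ht.le, mul_sub]

end bounded

end MarkovEI

/-! ### Dirichlet form, Fisher information and the linearised inequality. -/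

namespace MarkovEI

variable {X : Type*} [Countable X] [MeasurableSpace X] [MeasurableSingletonClass X]
  {k : X → X → ℝ} {μ : Measure X}

lemma summable_measureReal_mul {h : X → ℝ} (hh : Integrable h μ) :
    Summable fun x => μ.real {x} * h x := by
  have hfin : ∑' x, ‖h x‖ₑ * μ {x} ≠ ∞ := by
    rw [← lintegral_countable']
    exact hh.2.ne
  refine ((ENNReal.summable_toReal hfin).congr fun x => ?_).of_norm
  rw [ENNReal.toReal_mul, toReal_enorm, norm_mul, Real.norm_of_nonneg measureReal_nonneg, mul_comm]
  rfl

lemma integrable_of_abs_le {h : X → ℝ} {C : ℝ} [IsFiniteMeasure μ]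
    (hh : ∀ x, |h x| ≤ C) : Integrable h μ :=
  Integrable.of_bound AEStronglyMeasurable.of_discrete C (Eventually.of_forall hh)

section Dirichlet

variable (hk : IsRateMatrix k) (hM1 : Integrable (M1 k) μ)
include hk hM1

/-- Off the diagonal, `μ.real {x} * k x y` has total mass `∫ M1 dμ`; the negative rates `k x x` are
killed by `a x x = 0`. -/
lemma summable_offDiag_prod {a : X → X → ℝ} {D : ℝ} (ha : ∀ x y, |a x y| ≤ D)
    (hdiag : ∀ x, a x x = 0) :
    Summable fun p : X × X => μ.real {p.1} * k p.1 p.2 * a p.1 p.2 := by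
  classical
  set b : X × X → ℝ := fun p => if p.2 = p.1 then 0 else μ.real {p.1} * k p.1 p.2 with hb
  have hb0 : 0 ≤ b := fun p => by
    simp only [hb, Pi.zero_apply]
    split_ifs with h
    · rfl
    · exact mul_nonneg measureReal_nonneg (hk.nonneg _ _ (Ne.symm h))
  have hsub (x : X) : Summable fun y => b (x, y) := by
    refine ((hk.rowSum x).summable.abs.mul_left (μ.real {x})).of_norm_bounded fun y => ?_
    simp only [hb]
    split_ifs
    · simpa using mul_nonneg measureReal_nonneg (abs_nonneg _)
    · rw [norm_mul, Real.norm_of_nonneg measureReal_nonneg, Real.norm_eq_abs]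
  have hsum (x : X) : ∑' y, b (x, y) = μ.real {x} * M1 k x := by
    rw [tsum_eq_add_tsum_ne (hsub x) x, M1, ← tsum_mul_left]
    simp only [hb, if_true, zero_add]
    exact tsum_congr fun y => if_neg y.2
  have hbs : Summable b := (summable_prod_of_nonneg hb0).2
    ⟨hsub, by simpa only [hsum] using summable_measureReal_mul hM1⟩
  refine (hbs.mul_right D).of_norm_bounded fun p => ?_
  by_cases h : p.2 = p.1
  · simp [hb, h, hdiag]
  · simp only [hb, if_neg h]
    rw [norm_mul, Real.norm_of_nonneg (mul_nonneg measureReal_nonneg (hk.nonneg _ _ (Ne.symm h)))]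
    exact mul_le_mul_of_nonneg_left (ha _ _)
      (mul_nonneg measureReal_nonneg (hk.nonneg _ _ (Ne.symm h)))

lemma integrable_generator_mul {u g : X → ℝ} {C D : ℝ} (hu : ∀ x, |u x| ≤ C)
    (hg : ∀ x, |g x| ≤ D) : Integrable (fun x => (∑' y, k x y * u y) * g x) μ := by
  refine ((hM1.const_mul (2 * C)).mul_const D).mono' AEStronglyMeasurable.of_discrete
    (Eventually.of_forall fun x => ?_)
  rw [norm_mul]
  exact mul_le_mul (abs_tsum_rate_mul_le hk x hu) (hg x) (norm_nonneg _)
    ((abs_nonneg _).trans (abs_tsum_rate_mul_le hk x hu))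

/-- Integration by parts for a reversible generator. -/
lemma integral_generator_mul (hdb : DetailedBalance k μ) {u g : X → ℝ} {C D : ℝ}
    (hu : ∀ x, |u x| ≤ C) (hg : ∀ x, |g x| ≤ D) :
    ∫ x, (∑' y, k x y * u y) * g x ∂μ = -(1 / 2) * ∑' p : X × X,
      μ.real {p.1} * k p.1 p.2 * ((u p.2 - u p.1) * (g p.2 - g p.1)) := by
  have habs {x y : X} : |u y - u x| ≤ 2 * C := (abs_sub _ _).trans (by linarith [hu x, hu y])
  have hC {x : X} : 0 ≤ 2 * C := by linarith [(abs_nonneg _).trans (hu x)]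
  set A : X × X → ℝ := fun p => μ.real {p.1} * k p.1 p.2 * ((u p.2 - u p.1) * g p.1) with hA
  have hAs : Summable A := summable_offDiag_prod hk hM1 (a := fun x y => (u y - u x) * g x)
    (D := 2 * C * D)
    (fun x y => by
      rw [abs_mul]
      exact mul_le_mul habs (hg x) (abs_nonneg _) (hC (x := x))) (by simp)
  have h1 : ∫ x, (∑' y, k x y * u y) * g x ∂μ = ∑' p, A p := by
    rw [integral_countable (integrable_generator_mul hk hM1 hu hg), hAs.tsum_prod]
    refine tsum_congr fun x => ?_
    have hL : ∑' y, k x y * u y = ∑' y, k x y * (u y - u x) := by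
      simp_rw [mul_sub]
      rw [(summable_rate_mul hk x hu).tsum_sub ((hk.rowSum x).summable.mul_right _),
        tsum_mul_right, (hk.rowSum x).tsum_eq]
      simp
    rw [hL, smul_eq_mul, ← tsum_mul_right, ← tsum_mul_left]
    refine tsum_congr fun y => ?_
    simp only [hA]
    ring
  have h2 : ∑' p, A p = ∑' p, A (Prod.swap p) := ((Equiv.prodComm X X).tsum_eq A).symm
  -- Exchanging the two states preserves the weight by detailed balance and flips the sign of the
  -- increment of `u`.
  have h3 : ∑' p, A p + ∑' p, A (Prod.swap p) = -∑' p : X × X,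
      μ.real {p.1} * k p.1 p.2 * ((u p.2 - u p.1) * (g p.2 - g p.1)) := by
    have hAs' : Summable fun p => A (Prod.swap p) := (Equiv.prodComm X X).summable_iff.2 hAs
    rw [← hAs.tsum_add hAs', ← tsum_neg]
    refine tsum_congr fun p => ?_
    simp only [hA, Prod.fst_swap, Prod.snd_swap]
    rw [hdb p.2 p.1]
    ring
  rw [h1]
  linarith

/-- Monotonicity of `log` makes every term nonnegative, so truncation by `ENNReal.ofReal` loses
nothing; the bounds on `g` and `log g` make the sum finite. -/
lemma fisherInfo_eq {g : X → ℝ} {D : ℝ} (hg0 : ∀ x, 0 < g x) (hg : ∀ x, |g x| ≤ D)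
    (hlog : ∀ x, |Real.log (g x)| ≤ D) :
    fisherInfo k μ g ≠ ∞ ∧ (fisherInfo k μ g).toReal = 1 / 2 * ∑' p : X × X,
      μ.real {p.1} * k p.1 p.2 * ((g p.2 - g p.1) * (Real.log (g p.2) - Real.log (g p.1))) := by
  have hs := summable_offDiag_prod hk hM1
    (a := fun x y => (g y - g x) * (Real.log (g y) - Real.log (g x))) (D := (2 * D) * (2 * D))
    (fun x y => by
      rw [abs_mul]
      have hD : 0 ≤ D := (abs_nonneg _).trans (hg x)
      exact mul_le_mul ((abs_sub _ _).trans (by linarith [hg x, hg y]))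
        ((abs_sub _ _).trans (by linarith [hlog x, hlog y])) (abs_nonneg _) (by linarith))
    (by simp)
  have h0 (p : X × X) : 0 ≤ μ.real {p.1} * k p.1 p.2 *
      ((g p.2 - g p.1) * (Real.log (g p.2) - Real.log (g p.1))) := by
    by_cases h : p.1 = p.2
    · simp [h]
    refine mul_nonneg (mul_nonneg measureReal_nonneg (hk.nonneg _ _ h)) ?_
    rcases le_total (g p.1) (g p.2) with hle | hle
    · exact mul_nonneg (sub_nonneg.2 hle) (sub_nonneg.2 (Real.log_le_log (hg0 _) hle))
    · exact mul_nonneg_of_nonpos_of_nonpos (sub_nonpos.2 hle)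
        (sub_nonpos.2 (Real.log_le_log (hg0 _) hle))
  have h : fisherInfo k μ g = ENNReal.ofReal (1 / 2 * ∑' p : X × X, μ.real {p.1} * k p.1 p.2 *
      ((g p.2 - g p.1) * (Real.log (g p.2) - Real.log (g p.1)))) := by
    rw [ENNReal.ofReal_mul (by norm_num), ENNReal.ofReal_tsum_of_nonneg h0 hs, ENNReal.tsum_prod',
      fisherInfo]
    congr 1
    · rw [one_div, ENNReal.ofReal_inv_of_pos two_pos]
      simp
    · refine tsum_congr fun x => tsum_congr fun y => ?_
      congr 1
      ring
  rw [h]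
  exact ⟨ENNReal.ofReal_ne_top,
    ENNReal.toReal_ofReal (mul_nonneg (by norm_num) (tsum_nonneg h0))⟩

/-- The entropy-information inequality, applied to the density proportional to `exp (r * u)` and
linearised at `ρ * r`. -/
lemma entropy_exp_le [IsProbabilityMeasure μ] (hdb : DetailedBalance k μ) {Φ : ℝ → ℝ} (hΦ : IsGrowthFunction Φ)
    (hEI : SatisfiesEI k μ Φ) {u : X → ℝ} {C : ℝ} (hu : ∀ x, |u x| ≤ C) {r s : ℝ} (hr : 0 < r)
    (hs : 0 < s) :
    r * ∫ x, (u x + deriv Φ s * ∑' y, k x y * u y) * Real.exp (r * u x) ∂μ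
        - (∫ x, Real.exp (r * u x) ∂μ) * Real.log (∫ x, Real.exp (r * u x) ∂μ)
      ≤ (∫ x, Real.exp (r * u x) ∂μ) * (Φ s - s * deriv Φ s) := by
  set Z := ∫ x, Real.exp (r * u x) ∂μ with hZ
  have hru (x : X) : |r * u x| ≤ r * C := by
    rw [abs_mul, abs_of_pos hr]
    exact mul_le_mul_of_nonneg_left (hu x) hr.le
  have hexp (x : X) : |Real.exp (r * u x)| ≤ Real.exp (r * C) := by
    rw [Real.abs_exp]
    exact Real.exp_le_exp.2 ((le_abs_self _).trans (hru x))
  have hei : Integrable (fun x => Real.exp (r * u x)) μ := integrable_of_abs_le hexp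
  have hZ0 : 0 < Z := integral_exp_pos hei
  have huei : Integrable (fun x => u x * Real.exp (r * u x)) μ :=
    hei.bdd_mul (c := C) AEStronglyMeasurable.of_discrete (Eventually.of_forall hu)
  set g : X → ℝ := fun x => Real.exp (r * u x) / Z with hg
  have hg0 (x : X) : 0 < g x := div_pos (Real.exp_pos _) hZ0
  have hlogg (x : X) : Real.log (g x) = r * u x - Real.log Z := by
    rw [hg, Real.log_div (Real.exp_pos _).ne' hZ0.ne', Real.log_exp]
  have hgb (x : X) : |g x| ≤ Real.exp (r * C) / Z := by
    rw [hg, abs_div, abs_of_pos hZ0]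
    exact div_le_div_of_nonneg_right (hexp x) hZ0.le
  have hlogb (x : X) : |Real.log (g x)| ≤ r * C + |Real.log Z| := by
    rw [hlogg]
    exact (abs_sub _ _).trans (by linarith [hru x])
  have hgint : ∫ x, g x ∂μ = 1 := by
    rw [hg, integral_div, ← hZ, div_self hZ0.ne']
  have hglog : (fun x => g x * Real.log (g x)) =
      fun x => r / Z * (u x * Real.exp (r * u x)) - Real.log Z / Z * Real.exp (r * u x) := by
    ext x
    rw [hlogg, hg]
    ring
  have hglogi : Integrable (fun x => g x * Real.log (g x)) μ := by
    rw [hglog]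
    exact (huei.const_mul _).sub (hei.const_mul _)
  have hent : entropy μ g = r / Z * ∫ x, u x * Real.exp (r * u x) ∂μ - Real.log Z := by
    rw [entropy, hgint, hglog, integral_sub (huei.const_mul _) (hei.const_mul _),
      integral_const_mul, integral_const_mul, ← hZ, div_mul_cancel₀ _ hZ0.ne']
    simp
  obtain ⟨hIfin, hI⟩ := fisherInfo_eq hk hM1 hg0 (fun x => (hgb x).trans (le_max_left _ _))
    (fun x => (hlogb x).trans (le_max_right _ _))
  -- The increments of `log g` are exactly `r` times those of `u`, so summation by parts applies as
  -- it stands.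
  have hI' : (fisherInfo k μ g).toReal =
      -(r / Z) * ∫ x, (∑' y, k x y * u y) * Real.exp (r * u x) ∂μ := by
    rw [hI, integral_generator_mul hk hM1 hdb hu hexp, ← tsum_mul_left, ← tsum_mul_left,
      ← tsum_mul_left]
    refine tsum_congr fun p => ?_
    rw [hlogg, hlogg, hg]
    ring
  have key := (hEI g hg0 (hei.div_const Z) hgint hglogi hIfin).trans
    (hΦ.growthValue_le hs ENNReal.toReal_nonneg)
  rw [hI', hent] at key
  have hsplit : ∫ x, (u x + deriv Φ s * ∑' y, k x y * u y) * Real.exp (r * u x) ∂μ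
      = ∫ x, u x * Real.exp (r * u x) ∂μ
        + deriv Φ s * ∫ x, (∑' y, k x y * u y) * Real.exp (r * u x) ∂μ := by
    rw [← integral_const_mul, ← integral_add huei
      ((integrable_generator_mul hk hM1 hu hexp).const_mul _)]
    congr 1
    ext x
    ring
  rw [hsplit]
  have := mul_le_mul_of_nonneg_left key hZ0.le
  field_simp at this
  linarith

end Dirichlet

end MarkovEI

/-! ### Monotonicity along the time change and the norm bounds. -/

namespace MarkovEI

lemma abs_exp_mul_le {u C r q : ℝ} (hu : |u| ≤ C) (hr : 0 ≤ r) (hrq : r ≤ q) :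
    |Real.exp (r * u)| ≤ Real.exp (q * C) := by
  rw [Real.abs_exp]
  exact Real.exp_le_exp.2 ((mul_le_mul_of_nonneg_left ((le_abs_self u).trans hu) hr).trans
    (mul_le_mul_of_nonneg_right hrq ((abs_nonneg u).trans hu)))

section timeChange

variable {X : Type*} [Countable X] {k : X → X → ℝ} (hk : IsRateMatrix k)
  {Φ : ℝ → ℝ} (hΦ : IsGrowthFunction Φ) {f : X → ℝ} {C : ℝ} (hf : ∀ x, |f x| ≤ C)
  {ρ p : ℝ} (hρ : 0 < ρ) (hp : 0 < p)
include hk hΦ hf hρ hp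

lemma abs_semigroup_timeOf_le {r : ℝ} (hr : p ≤ r) (x : X) :
    |semigroup k (timeOf Φ ρ p r) f x| ≤ C :=
  abs_semigroup_le hk hf (hΦ.timeOf_nonneg hρ hp hr) x

/-- The choice of `t(r)` is made for this: the factor `r` cancels the `1 / r` in `t'(r)`, leaving
the tangent slope `Φ'(ρ r)`. -/
lemma hasDerivAt_semigroup_timeOf {r : ℝ} (hr : p < r) (x : X) :
    HasDerivAt (fun r => r * semigroup k (timeOf Φ ρ p r) f x)
      (semigroup k (timeOf Φ ρ p r) f x
        + deriv Φ (ρ * r) * ∑' y, k x y * semigroup k (timeOf Φ ρ p r) f y) r := by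
  have h := (hasDerivAt_semigroup hk hf (hΦ.timeOf_pos hρ hp hr) x).comp r
    (hΦ.hasDerivAt_timeOf hρ hp hr.le)
  refine ((hasDerivAt_id' r).fun_mul h).congr_deriv ?_
  have : r ≠ 0 := (hp.trans hr).ne'
  simp only [Function.comp]
  field_simp

end timeChange

variable {X : Type*} [Countable X] [MeasurableSpace X] [MeasurableSingletonClass X]
  {k : X → X → ℝ} {μ : Measure X} [IsProbabilityMeasure μ]

lemma eLpNorm_exp_eq {u : X → ℝ} {C : ℝ} (hu : ∀ x, |u x| ≤ C) {q : ℝ} (hq : 0 < q) :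
    eLpNorm (fun x => Real.exp (u x)) (ENNReal.ofReal q) μ
      = ENNReal.ofReal (Real.exp (Real.log (∫ x, Real.exp (q * u x) ∂μ) / q)) := by
  have hei : Integrable (fun x => Real.exp (q * u x)) μ :=
    integrable_of_abs_le fun x => abs_exp_mul_le (hu x) hq.le le_rfl
  have hZ : 0 < ∫ x, Real.exp (q * u x) ∂μ := integral_exp_pos hei
  rw [eLpNorm_eq_lintegral_rpow_enorm_toReal (by simpa using hq) ENNReal.ofReal_ne_top,
    ENNReal.toReal_ofReal hq.le]
  have : ∫⁻ x, ‖Real.exp (u x)‖ₑ ^ q ∂μ = ENNReal.ofReal (∫ x, Real.exp (q * u x) ∂μ) := by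
    rw [ofReal_integral_eq_lintegral_ofReal hei (Eventually.of_forall fun x => Real.exp_nonneg _)]
    refine lintegral_congr fun x => ?_
    rw [Real.enorm_eq_ofReal (Real.exp_nonneg _), ENNReal.ofReal_rpow_of_pos (Real.exp_pos _),
      ← Real.exp_mul, mul_comm]
  rw [this, ENNReal.ofReal_rpow_of_pos hZ, Real.rpow_def_of_pos hZ, mul_one_div]

variable (hk : IsRateMatrix k) (hM1 : Integrable (M1 k) μ) (hdb : DetailedBalance k μ)
  {Φ : ℝ → ℝ} (hΦ : IsGrowthFunction Φ) (hEI : SatisfiesEI k μ Φ)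
  {f : X → ℝ} {C : ℝ} (hf : ∀ x, |f x| ≤ C) {ρ p : ℝ} (hρ : 0 < ρ) (hp : 0 < p)
include hk hΦ hf hρ hp

/-- Supplies the endpoint `r = p`: there `t = 0`, and the backward equation is only available at
positive times. -/
lemma continuousOn_integral_exp :
    ContinuousOn (fun r => ∫ x, Real.exp (r * semigroup k (timeOf Φ ρ p r) f x) ∂μ) (Ici p) := by
  have hIcc (q : ℝ) : ContinuousOn
      (fun r => ∫ x, Real.exp (r * semigroup k (timeOf Φ ρ p r) f x) ∂μ) (Icc p q) := by
    refine continuousOn_of_dominated (bound := fun _ => Real.exp (q * C))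
      (fun _ _ => AEStronglyMeasurable.of_discrete) (fun r hr => ?_) (integrable_const _) ?_
    · exact Eventually.of_forall fun x => abs_exp_mul_le
        (abs_semigroup_timeOf_le hk hΦ hf hρ hp hr.1 x) (hp.le.trans hr.1) hr.2
    · refine Eventually.of_forall fun x => ?_
      refine (continuousOn_id.mul ((continuousOn_semigroup hk hf x).comp (fun r hr => ?_)
        fun r hr => hΦ.timeOf_nonneg hρ hp hr.1)).rexp
      exact (hΦ.hasDerivAt_timeOf hρ hp hr.1).continuousAt.continuousWithinAt
  intro r hr
  refine (hIcc (r + 1) r ⟨hr, by linarith⟩).mono_of_mem_nhdsWithin ?_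
  filter_upwards [self_mem_nhdsWithin,
    mem_nhdsWithin_of_mem_nhds (Iio_mem_nhds (lt_add_one r))] with s hs hs'
  exact ⟨hs, le_of_lt hs'⟩

include hM1

lemma hasDerivAt_integral_exp {r : ℝ} (hr : p < r) :
    HasDerivAt (fun r => ∫ x, Real.exp (r * semigroup k (timeOf Φ ρ p r) f x) ∂μ)
      (∫ x, (semigroup k (timeOf Φ ρ p r) f x + deriv Φ (ρ * r) *
        ∑' y, k x y * semigroup k (timeOf Φ ρ p r) f y) *
          Real.exp (r * semigroup k (timeOf Φ ρ p r) f x) ∂μ) r := by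
  -- Any bound above `Φ'(ρ r)` would do; by continuity it still dominates the slope near `r`.
  set K := deriv Φ (ρ * r) + 1 with hK
  have hr0 : 0 < r := hp.trans hr
  have hcont : ContinuousAt (fun s => deriv Φ (ρ * s)) r :=
    ContinuousAt.comp (f := fun s => ρ * s)
      (hΦ.continuousOn_deriv.continuousAt (Ioi_mem_nhds (mul_pos hρ hr0))) (by fun_prop)
  set S : Set ℝ := {s | p < s ∧ s < r + 1 ∧ deriv Φ (ρ * s) < K} with hS
  have hSn : S ∈ 𝓝 r := by
    filter_upwards [Ioi_mem_nhds hr, Iio_mem_nhds (lt_add_one r),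
      hcont.eventually_lt continuousAt_const (lt_add_one _)] with s h1 h2 h3
    exact ⟨h1, h2, h3⟩
  have hexp {s : ℝ} (hs : p < s) (hs' : s < r + 1) (x : X) :
      |Real.exp (s * semigroup k (timeOf Φ ρ p s) f x)| ≤ Real.exp ((r + 1) * C) :=
    abs_exp_mul_le (abs_semigroup_timeOf_le hk hΦ hf hρ hp hs.le x) (hp.trans hs).le hs'.le
  refine (hasDerivAt_integral_of_dominated_loc_of_deriv_le (s := S)
    (bound := fun x => (C + K * (2 * C * M1 k x)) * Real.exp ((r + 1) * C))
    (F' := fun r x => (semigroup k (timeOf Φ ρ p r) f x + deriv Φ (ρ * r) *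
        ∑' y, k x y * semigroup k (timeOf Φ ρ p r) f y) *
          Real.exp (r * semigroup k (timeOf Φ ρ p r) f x)) hSn
    (Eventually.of_forall fun _ => AEStronglyMeasurable.of_discrete)
    (integrable_of_abs_le (hexp hr (lt_add_one r))) AEStronglyMeasurable.of_discrete
    (Eventually.of_forall fun x s hs => ?_) ?_ (Eventually.of_forall fun x s hs => ?_)).2
  · have h1 := abs_semigroup_timeOf_le hk hΦ hf hρ hp hs.1.le
    have h2 := abs_tsum_rate_mul_le hk x h1
    have hd := hΦ.deriv_pos (mul_pos hρ (hp.trans hs.1))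
    rw [norm_mul, Real.norm_eq_abs, Real.norm_eq_abs]
    have h3 : |semigroup k (timeOf Φ ρ p s) f x + deriv Φ (ρ * s) *
        ∑' y, k x y * semigroup k (timeOf Φ ρ p s) f y| ≤ C + K * (2 * C * M1 k x) := by
      refine (abs_add_le _ _).trans (add_le_add (h1 x) ?_)
      rw [abs_mul, abs_of_pos hd]
      exact mul_le_mul hs.2.2.le h2 (abs_nonneg _) (hd.trans hs.2.2).le
    exact mul_le_mul h3 (hexp hs.1 hs.2.1 x) (abs_nonneg _) ((abs_nonneg _).trans h3)
  · exact ((integrable_const C).add ((hM1.const_mul _).const_mul K)).mul_const _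
  · refine ((hasDerivAt_semigroup_timeOf hk hΦ hf hρ hp hs.1 x).exp).congr_deriv ?_
    ring

include hdb hEI

/-- The numerator of the derivative over `r ^ 2` is `r Z'/Z - log Z + ρ r Φ'(ρ r) - Φ(ρ r)`,
nonpositive by `entropy_exp_le` at `s = ρ * r` after multiplication by `Z`. -/
lemma antitoneOn_log_integral_exp :
    AntitoneOn (fun r => Real.log (∫ x, Real.exp (r * semigroup k (timeOf Φ ρ p r) f x) ∂μ) / r
      + Φ (ρ * r) / r) (Ici p) := by
  have hpos {r : ℝ} (hr : p ≤ r) :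
      0 < ∫ x, Real.exp (r * semigroup k (timeOf Φ ρ p r) f x) ∂μ :=
    integral_exp_pos (integrable_of_abs_le fun x => abs_exp_mul_le
      (abs_semigroup_timeOf_le hk hΦ hf hρ hp hr x) (hp.trans_le hr).le le_rfl)
  have hd {r : ℝ} (hr : p < r) := (((hasDerivAt_integral_exp hk hM1 hΦ hf hρ hp hr).log
    (hpos hr.le).ne').fun_div (hasDerivAt_id' r) (hp.trans hr).ne').fun_add
      (hΦ.hasDerivAt_div hρ (hp.trans hr))
  refine antitoneOn_of_deriv_nonpos (convex_Ici p) ?_ (fun r hr => ?_) fun r hr => ?_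
  · refine ContinuousOn.add (((continuousOn_integral_exp hk hΦ hf hρ hp).log
      fun r hr => (hpos hr).ne').div continuousOn_id fun r hr => (hp.trans_le hr).ne') ?_
    exact fun r hr =>
      (hΦ.hasDerivAt_div hρ (hp.trans_le hr)).continuousAt.continuousWithinAt
  · rw [interior_Ici] at hr
    exact (hd hr).differentiableAt.differentiableWithinAt
  · rw [interior_Ici] at hr
    have hr0 : 0 < r := hp.trans hr
    rw [(hd hr).deriv]
    have key := entropy_exp_le hk hM1 hdb hΦ hEI
      (abs_semigroup_timeOf_le hk hΦ hf hρ hp (le_of_lt hr)) hr0 (mul_pos hρ hr0)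
    have hZ := hpos (le_of_lt hr)
    set Z := ∫ x, Real.exp (r * semigroup k (timeOf Φ ρ p r) f x) ∂μ
    set J := ∫ x, (semigroup k (timeOf Φ ρ p r) f x + deriv Φ (ρ * r) *
      ∑' y, k x y * semigroup k (timeOf Φ ρ p r) f y) *
        Real.exp (r * semigroup k (timeOf Φ ρ p r) f x) ∂μ
    rw [← add_div]
    refine div_nonpos_of_nonpos_of_nonneg ?_ (sq_nonneg r)
    rw [← mul_le_mul_iff_of_pos_left hZ]
    have hJ : Z * (J / Z) = J := mul_div_cancel₀ J hZ.ne'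
    linear_combination key + r * hJ

lemma eLpNorm_exp_semigroup_le {q : ℝ} (hpq : p ≤ q) :
    eLpNorm (fun x => Real.exp (semigroup k (timeOf Φ ρ p q) f x)) (ENNReal.ofReal q) μ
      ≤ eLpNorm (fun x => Real.exp (f x)) (ENNReal.ofReal p) μ
        * ENNReal.ofReal (Real.exp (expOf Φ ρ p q)) := by
  have h := antitoneOn_log_integral_exp hk hM1 hdb hΦ hEI hf hρ hp self_mem_Ici hpq hpq
  have h0 : timeOf Φ ρ p p = 0 := by simp [timeOf]
  simp only [h0, semigroup_zero] at h
  rw [eLpNorm_exp_eq (abs_semigroup_timeOf_le hk hΦ hf hρ hp hpq) (hp.trans_le hpq),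
    eLpNorm_exp_eq hf hp, ← ENNReal.ofReal_mul (Real.exp_nonneg _), ← Real.exp_add]
  refine ENNReal.ofReal_le_ofReal (Real.exp_le_exp.2 ?_)
  rw [expOf]
  linarith

/-- One atom controls the supremum: `μ({x}) exp (q u(x)) ≤ Z(q)` gives `log μ({x}) / q + u(x) ≤ log
Z(q) / q`, and the first term vanishes as `q → ∞`. Continuity in time, within `[0, ∞)`, identifies
the limit of `u(x)`. -/
lemma eLpNorm_top_exp_semigroup_le {t m : ℝ}
    (ht : Tendsto (fun q => timeOf Φ ρ p q) atTop (𝓝 t))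
    (hm : Tendsto (fun q => expOf Φ ρ p q) atTop (𝓝 m)) :
    eLpNorm (fun x => Real.exp (semigroup k t f x)) ∞ μ
      ≤ eLpNorm (fun x => Real.exp (f x)) (ENNReal.ofReal p) μ
        * ENNReal.ofReal (Real.exp m) := by
  rw [eLpNorm_exp_eq hf hp, ← ENNReal.ofReal_mul (Real.exp_nonneg _), ← Real.exp_add,
    eLpNorm_exponent_top]
  refine eLpNormEssSup_le_of_ae_enorm_bound ?_
  rw [ae_iff_of_countable]
  intro x hx
  rw [Real.enorm_eq_ofReal (Real.exp_nonneg _)]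
  refine ENNReal.ofReal_le_ofReal (Real.exp_le_exp.2 ?_)
  have hx0 : 0 < μ.real {x} := ENNReal.toReal_pos hx (measure_ne_top _ _)
  have ht0 : 0 ≤ t := ge_of_tendsto ht
    ((eventually_ge_atTop p).mono fun q hq => hΦ.timeOf_nonneg hρ hp hq)
  have hu : Tendsto (fun q => semigroup k (timeOf Φ ρ p q) f x) atTop (𝓝 (semigroup k t f x)) :=
    (continuousOn_semigroup hk hf x t ht0).tendsto.comp (tendsto_nhdsWithin_iff.2
      ⟨ht, (eventually_ge_atTop p).mono fun q hq => hΦ.timeOf_nonneg hρ hp hq⟩)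
  have hlim : Tendsto (fun q => Real.log (μ.real {x}) / q + semigroup k (timeOf Φ ρ p q) f x) atTop
      (𝓝 (0 + semigroup k t f x)) := (tendsto_const_nhds.div_atTop tendsto_id).add hu
  rw [zero_add] at hlim
  refine le_of_tendsto_of_tendsto hlim (hm.const_add _) ?_
  filter_upwards [eventually_ge_atTop p] with q hq
  have hq0 := hp.trans_le hq
  have hub := abs_semigroup_timeOf_le hk hΦ hf hρ hp hq
  have hle := eLpNorm_exp_semigroup_le hk hM1 hdb hΦ hEI hf hρ hp hq
  rw [eLpNorm_exp_eq hub hq0, eLpNorm_exp_eq hf hp, ← ENNReal.ofReal_mul (Real.exp_nonneg _),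
    ← Real.exp_add, ENNReal.ofReal_le_ofReal_iff (Real.exp_nonneg _), Real.exp_le_exp] at hle
  refine le_trans ?_ hle
  have hei : Integrable (fun x => Real.exp (q * semigroup k (timeOf Φ ρ p q) f x)) μ :=
    integrable_of_abs_le fun x => abs_exp_mul_le (hub x) hq0.le le_rfl
  have hatom : μ.real {x} * Real.exp (q * semigroup k (timeOf Φ ρ p q) f x)
      ≤ ∫ x, Real.exp (q * semigroup k (timeOf Φ ρ p q) f x) ∂μ := by
    have := setIntegral_le_integral (s := {x}) hei (Eventually.of_forall fun x => Real.exp_nonneg _)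
    rwa [integral_singleton, smul_eq_mul] at this
  have hlog := Real.log_le_log (mul_pos hx0 (Real.exp_pos _)) hatom
  rw [Real.log_mul hx0.ne' (Real.exp_pos _).ne', Real.log_exp] at hlog
  rw [le_div_iff₀ hq0, add_mul, div_mul_cancel₀ _ hq0.ne']
  linarith

end MarkovEI

theorem mainTheorem4 {X : Type*} [Countable X] [MeasurableSpace X] [MeasurableSingletonClass X]
    (k : X → X → ℝ) (μ : Measure X) [IsProbabilityMeasure μ]
    (hk : MarkovEI.IsRateMatrix k) (hirr : MarkovEI.IsIrreducible k)
    (hdb : MarkovEI.DetailedBalance k μ)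
    (Φ : ℝ → ℝ) (hΦ : MarkovEI.IsGrowthFunction Φ) (hEI : MarkovEI.SatisfiesEI k μ Φ)
    (hM1 : Integrable (MarkovEI.M1 k) μ)
    (f : X → ℝ) (hf : ∃ C : ℝ, ∀ x, |f x| ≤ C) (ρ : ℝ) (hρ : 0 < ρ) :
    -- the case `1 ≤ p ≤ q < ∞`
    (∀ p q : ℝ, 1 ≤ p → p ≤ q →
      eLpNorm (fun x => Real.exp (MarkovEI.semigroup k (MarkovEI.timeOf Φ ρ p q) f x))
          (ENNReal.ofReal q) μ
        ≤ eLpNorm (fun x => Real.exp (f x)) (ENNReal.ofReal p) μ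
          * ENNReal.ofReal (Real.exp (MarkovEI.expOf Φ ρ p q))) ∧
    -- the case `1 ≤ p < q = ∞`, with `t(ϱ)` and `m(ϱ)` the limits as `q → ∞`
    (IntegrableAtFilter (fun r => deriv Φ r / r) atTop volume → ∀ p : ℝ, 1 ≤ p →
      ∃ t m : ℝ, Tendsto (fun q => MarkovEI.timeOf Φ ρ p q) atTop (𝓝 t) ∧
        Tendsto (fun q => MarkovEI.expOf Φ ρ p q) atTop (𝓝 m) ∧
        eLpNorm (fun x => Real.exp (MarkovEI.semigroup k t f x)) ∞ μ
          ≤ eLpNorm (fun x => Real.exp (f x)) (ENNReal.ofReal p) μ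
            * ENNReal.ofReal (Real.exp m)) ∧
    -- `q = ∞` is reached only under this integrability: otherwise `t(ϱ) = ∞` in the limit
    (¬ IntegrableAtFilter (fun r => deriv Φ r / r) atTop volume → ∀ p : ℝ, 1 ≤ p →
      Tendsto (fun q => MarkovEI.timeOf Φ ρ p q) atTop atTop) ∧
    -- the degenerate case `p = q = ∞`, where `t(ϱ) = 0` and `m(ϱ) = 0`
    eLpNorm (fun x => Real.exp (MarkovEI.semigroup k 0 f x)) ∞ μ
      ≤ eLpNorm (fun x => Real.exp (f x)) ∞ μ * ENNReal.ofReal (Real.exp 0) := by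
  obtain ⟨C, hC⟩ := hf
  refine ⟨fun p q hp hpq => MarkovEI.eLpNorm_exp_semigroup_le hk hM1 hdb hΦ hEI hC hρ
    (one_pos.trans_le hp) hpq, fun hint p hp => ?_, fun hint p hp =>
    hΦ.tendsto_timeOf_atTop hρ (one_pos.trans_le hp) hint, by simp [MarkovEI.semigroup_zero]⟩
  obtain ⟨t, ht⟩ := hΦ.exists_tendsto_timeOf hρ (one_pos.trans_le hp) hint
  obtain ⟨m, hm⟩ := hΦ.exists_tendsto_expOf hρ p
  exact ⟨t, m, ht, hm, MarkovEI.eLpNorm_top_exp_semigroup_le hk hM1 hdb hΦ hEI hC hρ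
    (one_pos.trans_le hp) ht hm⟩
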